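/- Let $\mathbb F$ be a field, let $\mathcal V$ be an $\mathbb F$-vector space with a basis $\beta=\{v_i\mid i\in\mathbb N\}$, ordered as $\mathbb N$, and let $G$ be any group (written multiplicatively, with identity $1$). Let $e_{ij}\in\mathrm{End}_{\mathbb F}\mathcal V$ be the matrix units, $e_{ij}(v_j)=v_i$ and $e_{ij}(v_k)=0$ for $k\ne j$. Let $$\mathrm{UT}_\beta\mathcal V=\{t\in\mathrm{End}_{\mathbb F}\mathcal V\mid t(v_j)\in\mathrm{Span}\{v_i\mid i\le j\}\text{ for all }j\},\qquad \mathrm{UT}_{\to\beta}\mathcal V=\mathrm{Span}\{e_{ij}\mid i\le j\}\subseteq\mathrm{UT}_\beta\mathcal V .$$ A $G$-grading $\Gamma$ on an algebra $\mathcal A$ is a vector space decomposition $\mathcal A=\bigoplus_{g\in G}\mathcal A_g$ with $\mathcal A_g\mathcal A_h\subseteq\mathcal A_{gh}$ for all $g,h\in G$; its support is $\{g\in G\mid\mathcal A_g\ne0\}$. Two $G$-gradings on $\mathcal A$ are isomorphic ($\cong$) if some algebra automorphism of $\mathcal A$ maps, for each $g$, the component of degree $g$ of the first into the component of degree $g$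 of the second. A grading on $\mathrm{UT}_\beta\mathcal V$ is elementary if there is a map $\gamma\colon\mathbb N\to G$ such that every $e_{ij}$, $i\le j$, is homogeneous of degree $\gamma(i)^{-1}\gamma(j)$. For a map $\eta\colon\mathbb N\setminus\{i_0\}\to G$, where $i_0$ is the first element of $\mathbb N$, extend $\eta$ by $\eta(i_0)=1$, and let $\Gamma(\eta)$ be the elementary $G$-grading on $\mathrm{UT}_{\to\beta}\mathcal V$ whose component of degree $g$ is $\mathrm{Span}\{e_{ij}\mid i\le j,\ \eta(i)^{-1}\eta(j)=g\}$. Give $\mathrm{End}_{\mathbb F}\mathcal V$ the finite topology (pointwise convergence, with $\mathcal V$ discrete) and its subspaces the induced topology. A $G$-grading on $\mathrm{UT}_\beta\mathcal V$ is called the extension $\overline{\Gamma(\eta)}$ of $\Gamma(\eta)$ if its projections onto the homogeneous components are continuous and extend those of $\Gamma(\eta)$. **Theorem.** 1. Every $G$-grading on $\mathrm{UT}_\beta\mathcal V$ has finite support and is isomorphic to an elementary grading on $\mathrm{UT}_\beta\mathcal V$ that is the extension $\overline{\Gamma(\eta)}$ of an elementary grading $\Gamma(\eta)$ on $\mathrm{UT}_{\to\beta}\mathcal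 V$, for some $\eta\colon\mathbb N\setminus\{i_0\}\to G$. 2. Let $\eta,\eta'\colon\mathbb N\setminus\{i_0\}\to G$ be maps such that $\Gamma(\eta)$ and $\Gamma(\eta')$ have extensions $\overline{\Gamma(\eta)}$ and $\overline{\Gamma(\eta')}$ to $G$-gradings on $\mathrm{UT}_\beta\mathcal V$. The following are equivalent: (i) $\overline{\Gamma(\eta)}\cong\overline{\Gamma(\eta')}$; (ii) $\Gamma(\eta)\cong\Gamma(\eta')$; (iii) $\eta=\eta'$. -/

import Mathlib

namespace TriangularGrading

noncomputable section

/-! ### Group gradings on associative algebras (not necessarily unital) -/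

/-- A `G`-grading on an associative `F`-algebra `A`: subspaces `A_g`, `g ∈ G`, with
`A = ⨁ A_g` and `A_g A_h ⊆ A_{gh}`. The group `G` is arbitrary and written multiplicatively. -/
structure GroupGrading (F G A : Type*) [Field F] [Group G] [NonUnitalRing A] [Module F A] where
  /-- The homogeneous component of degree `g`. -/
  comp : G → Submodule F A
  isInternal : letI := Classical.decEq G; DirectSum.IsInternal comp
  mul_mem : ∀ (g h : G) (x y : A), x ∈ comp g → y ∈ comp h → x * y ∈ comp (g * h)

namespace GroupGrading

variable {F G A B : Type*} [Field F] [Group G] [NonUnitalRing A] [Module F A]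
  [NonUnitalRing B] [Module F B]

/-- The support of a grading: the degrees with nonzero homogeneous component. -/
def support (Γ : GroupGrading F G A) : Set G := {g | Γ.comp g ≠ ⊥}

/-- The projection of `A` onto the component of degree `g` along the other components. -/
def proj (Γ : GroupGrading F G A) (g : G) : A →ₗ[F] A :=
  letI := Classical.decEq G
  (Γ.comp g).subtype ∘ₗ DirectSum.component F G (fun h => Γ.comp h) g ∘ₗ
    (LinearEquiv.ofBijective (DirectSum.coeLinearMap Γ.comp) Γ.isInternal).symm.toLinearMap

/-- `(A, Γ)` and `(B, Γ')` are isomorphic as graded algebras: there is an isomorphism of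
algebras (a multiplicative linear bijection) mapping `A_g` into `B_g` for all `g`. -/
def IsIsomorphic (Γ : GroupGrading F G A) (Γ' : GroupGrading F G B) : Prop :=
  ∃ f : A ≃ₗ[F] B, (∀ x y : A, f (x * y) = f x * f y) ∧
    ∀ (g : G) (x : A), x ∈ Γ.comp g → f x ∈ Γ'.comp g

end GroupGrading

/-! ### Triangular algebras with respect to an ordered basis -/

variable {F V ι : Type*} [Field F] [AddCommGroup V] [Module F V]

/-- The matrix unit `e_{ij}`: it maps `b j` to `b i` and the other basis vectors to `0`. -/
def matrixUnit (b : Module.Basis ι F V) (i j : ι) : Module.End F V :=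
  (b.coord j).smulRight (b i)

theorem matrixUnit_apply_self (b : Module.Basis ι F V) (i j : ι) :
    matrixUnit b i j (b j) = b i := by
  simp [matrixUnit]

theorem matrixUnit_apply_of_ne (b : Module.Basis ι F V) (i : ι) {j k : ι} (h : k ≠ j) :
    matrixUnit b i j (b k) = 0 := by
  simp [matrixUnit, h]

theorem matrixUnit_mul_same (b : Module.Basis ι F V) (i j k : ι) :
    matrixUnit b i j * matrixUnit b j k = matrixUnit b i k := by
  ext v; simp [matrixUnit]

theorem matrixUnit_mul_of_ne (b : Module.Basis ι F V) (i l : ι) {j k : ι} (h : j ≠ k) :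
    matrixUnit b i j * matrixUnit b k l = 0 := by
  ext v; simp [matrixUnit, h.symm]

theorem ext_entries (b : Module.Basis ι F V) {s t : Module.End F V}
    (h : ∀ i j, b.repr (s (b j)) i = b.repr (t (b j)) i) : s = t :=
  b.ext fun j => b.repr.injective (Finsupp.ext fun i => h i j)

variable [LinearOrder ι]

/-- `UT_β V`: the endomorphisms `t` with `t (b j) ∈ Span {b i | i ≤ j}` for all `j`. -/
def UT (b : Module.Basis ι F V) : Subalgebra F (Module.End F V) where
  carrier := {t | ∀ j, t (b j) ∈ Submodule.span F (b '' Set.Iic j)}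
  mul_mem' := by
    intro s t hs ht j
    have key : Submodule.span F (b '' Set.Iic j) ≤
        (Submodule.span F (b '' Set.Iic j)).comap s := by
      rw [Submodule.span_le]
      rintro _ ⟨i, hi, rfl⟩
      exact Submodule.span_mono (Set.image_mono (Set.Iic_subset_Iic.2 hi)) (hs i)
    exact key (ht j)
  add_mem' := fun hs ht j => Submodule.add_mem _ (hs j) (ht j)
  algebraMap_mem' := fun c j => by
    rw [Module.algebraMap_end_apply]
    exact Submodule.smul_mem _ _ (Submodule.subset_span ⟨j, le_refl j, rfl⟩)

/-- `UT_{→β} V`: the span of the matrix units `e_{ij}`, `i ≤ j`; an algebra without unit if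
`β` is infinite. -/
def UTlim (b : Module.Basis ι F V) : NonUnitalSubalgebra F (Module.End F V) :=
  { Submodule.span F {t | ∃ i j, i ≤ j ∧ t = matrixUnit b i j} with
    mul_mem' := by
      intro s t hs ht
      have h : s * t ∈ Submodule.span F {t | ∃ i j, i ≤ j ∧ t = matrixUnit b i j} *
          Submodule.span F {t | ∃ i j, i ≤ j ∧ t = matrixUnit b i j} :=
        Submodule.mul_mem_mul hs ht
      rw [Submodule.span_mul_span] at h
      refine (Submodule.span_le.2 ?_) h
      rintro _ ⟨_, ⟨i, j, hij, rfl⟩, _, ⟨k, l, hkl, rfl⟩, rfl⟩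
      by_cases hjk : j = k
      · subst hjk
        exact Submodule.subset_span ⟨i, l, hij.trans hkl, matrixUnit_mul_same b i j l⟩
      · change matrixUnit b i j * matrixUnit b k l ∈ Submodule.span F _
        rw [matrixUnit_mul_of_ne b i l hjk]
        exact Submodule.zero_mem _ }

theorem mem_UTlim {b : Module.Basis ι F V} {t : Module.End F V} :
    t ∈ UTlim b ↔ t ∈ Submodule.span F {t | ∃ i j, i ≤ j ∧ t = matrixUnit b i j} := Iff.rfl

theorem matrixUnit_mem_UTlim (b : Module.Basis ι F V) {i j : ι} (h : i ≤ j) :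
    matrixUnit b i j ∈ UTlim b :=
  Submodule.subset_span ⟨i, j, h, rfl⟩

theorem matrixUnit_mem_UT (b : Module.Basis ι F V) {i j : ι} (h : i ≤ j) :
    matrixUnit b i j ∈ UT b := by
  intro k
  by_cases hk : k = j
  · subst hk
    rw [matrixUnit_apply_self]
    exact Submodule.subset_span ⟨i, h, rfl⟩
  · rw [matrixUnit_apply_of_ne b i hk]
    exact Submodule.zero_mem _

theorem UTlim_le_UT (b : Module.Basis ι F V) {t : Module.End F V} (ht : t ∈ UTlim b) :
    t ∈ UT b := by
  have h : Submodule.span F {t | ∃ i j, i ≤ j ∧ t = matrixUnit b i j} ≤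
      Subalgebra.toSubmodule (UT b) := by
    rw [Submodule.span_le]
    rintro _ ⟨i, j, hij, rfl⟩
    exact matrixUnit_mem_UT b hij
  exact h ht

/-- The inclusion of `UT_{→β} V` in `UT_β V`. -/
def incl (b : Module.Basis ι F V) (t : UTlim b) : UT b := ⟨t.1, UTlim_le_UT b t.2⟩

/-- The finite topology on `End_F V`: pointwise convergence, where `V` is discrete. -/
@[reducible] def finiteTopology (F V : Type*) [Field F] [AddCommGroup V] [Module F V] :
    TopologicalSpace (Module.End F V) :=
  TopologicalSpace.induced (fun t : Module.End F V => (t : V → V))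
    (@Pi.topologicalSpace V (fun _ => V) (fun _ => ⊥))

/-- The topology induced on `UT_β V` by the finite topology of `End_F V`. -/
@[reducible] def topologyUT (b : Module.Basis ι F V) : TopologicalSpace (UT b) :=
  TopologicalSpace.induced Subtype.val (finiteTopology F V)

/-! ### Elementary gradings and their extensions -/

variable {G : Type*} [Group G]

/-- The subspace of `UT_{→β} V` spanned by the `e_{ij}`, `i ≤ j`, with
`γ(i)⁻¹ γ(j) = g`. -/
def elementaryComp (b : Module.Basis ι F V) (γ : ι → G) (g : G) : Submodule F (UTlim b) :=
  Submodule.span F {t | ∃ i j, i ≤ j ∧ (γ i)⁻¹ * γ j = g ∧ t.1 = matrixUnit b i j}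

theorem entry_eq_zero_of_mem (b : Module.Basis ι F V) (γ : ι → G) {g : G} {t : UTlim b}
    (ht : t ∈ elementaryComp b γ g) {i j : ι} (hij : (γ i)⁻¹ * γ j ≠ g) :
    b.repr (t.1 (b j)) i = 0 := by
  induction ht using Submodule.span_induction with
  | mem x hx =>
    obtain ⟨k, l, _, hg, hx⟩ := hx
    rw [hx]
    by_cases hjl : j = l
    · subst hjl
      have hki : k ≠ i := by rintro rfl; exact hij hg
      simp [matrixUnit_apply_self, hki]
    · simp [matrixUnit_apply_of_ne b k hjl]
  | zero => simp
  | add x y _ _ hx hy => simpa [hx] using hy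
  | smul c x _ hx => simp [hx]

theorem iSup_elementaryComp (b : Module.Basis ι F V) (γ : ι → G) :
    ⨆ g, elementaryComp b γ g = ⊤ := by
  rw [eq_top_iff]
  rintro ⟨t, ht⟩ -
  have hle : Submodule.span F {t | ∃ i j, i ≤ j ∧ t = matrixUnit b i j} ≤
      (⨆ g, elementaryComp b γ g).map (UTlim b).toSubmodule.subtype := by
    rw [Submodule.span_le]
    rintro _ ⟨i, j, hij, rfl⟩
    exact ⟨⟨matrixUnit b i j, matrixUnit_mem_UTlim b hij⟩,
      Submodule.mem_iSup_of_mem ((γ i)⁻¹ * γ j) (Submodule.subset_span ⟨i, j, hij, rfl, rfl⟩), rfl⟩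
  obtain ⟨s, hs, hst⟩ := hle ht
  have : s = ⟨t, ht⟩ := Subtype.ext hst
  exact this ▸ hs

/-- The elementary grading `Γ(γ)` on `UT_{→β} V` in which `e_{ij}` has degree
`γ(i)⁻¹ γ(j)`. -/
def elementaryGrading (b : Module.Basis ι F V) (γ : ι → G) : GroupGrading F G (UTlim b) where
  comp := elementaryComp b γ
  isInternal := by
    let _ := Classical.decEq G
    refine ⟨?_, ?_⟩
    · have key : ∀ (x : DirectSum G fun g => elementaryComp b γ g) (i j : ι),
          b.repr ((DirectSum.coeAddMonoidHom (elementaryComp b γ) x).1 (b j)) i =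
            b.repr ((x ((γ i)⁻¹ * γ j)).1.1 (b j)) i := by
        classical
        intro x i j
        let φ : UTlim b →ₗ[F] F :=
          { toFun := fun t => b.repr (t.1 (b j)) i
            map_add' := fun s t => by simp
            map_smul' := fun c t => by simp }
        change φ (DirectSum.coeAddMonoidHom (elementaryComp b γ) x) = φ (x ((γ i)⁻¹ * γ j)).1
        rw [DirectSum.coeAddMonoidHom_eq_dfinsuppSum, DFinsupp.sum, map_sum]
        refine Finset.sum_eq_single _ (fun h _ hne => ?_) (fun hg => ?_)
        · exact entry_eq_zero_of_mem b γ (x h).2 hne.symm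
        · rw [DFinsupp.notMem_support_iff.1 hg]
          exact map_zero φ
      intro x y hxy
      refine DFinsupp.ext fun g => Subtype.ext (Subtype.ext (ext_entries b fun i j => ?_))
      by_cases hij : (γ i)⁻¹ * γ j = g
      · subst hij
        rw [← key x i j, ← key y i j, hxy]
      · rw [entry_eq_zero_of_mem b γ (x g).2 hij, entry_eq_zero_of_mem b γ (y g).2 hij]
    · intro t
      have ht : t ∈ LinearMap.range (DirectSum.coeLinearMap (elementaryComp b γ)) := by
        rw [DirectSum.range_coeLinearMap, iSup_elementaryComp]
        exact Submodule.mem_top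
      exact ht
  mul_mem := by
    intro g h x y hx hy
    induction hx using Submodule.span_induction with
    | zero => rw [zero_mul]; exact Submodule.zero_mem _
    | add x x' _ _ hx hx' => rw [add_mul]; exact Submodule.add_mem _ hx hx'
    | smul c x _ hx => rw [smul_mul_assoc]; exact Submodule.smul_mem _ c hx
    | mem x hx =>
      induction hy using Submodule.span_induction with
      | zero => rw [mul_zero]; exact Submodule.zero_mem _
      | add y y' _ _ hy hy' => rw [mul_add]; exact Submodule.add_mem _ hy hy'
      | smul c y _ hy => rw [mul_smul_comm]; exact Submodule.smul_mem _ c hy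
      | mem y hy =>
        obtain ⟨i, j, hij, hg, hx⟩ := hx
        obtain ⟨k, l, hkl, hh, hy⟩ := hy
        have hxy : (x * y).1 = matrixUnit b i j * matrixUnit b k l := by
          rw [← hx, ← hy]; rfl
        by_cases hjk : j = k
        · subst hjk
          rw [matrixUnit_mul_same] at hxy
          refine Submodule.subset_span ⟨i, l, hij.trans hkl, ?_, hxy⟩
          rw [← hg, ← hh]; group
        · rw [matrixUnit_mul_of_ne b i l hjk] at hxy
          have h0 : x * y = 0 := Subtype.ext hxy
          rw [h0]
          exact Submodule.zero_mem _

/-- The degree function with value `1` at the first element and `η` elsewhere. -/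
def extendByOne (η : {i : ℕ // i ≠ 0} → G) (i : ℕ) : G :=
  if h : i = 0 then 1 else η ⟨i, h⟩

/-- A grading on `UT_β V` is elementary if for some `γ` all `e_{ij}`, `i ≤ j`, are homogeneous
of degree `γ(i)⁻¹ γ(j)`. -/
def IsElementary (b : Module.Basis ι F V) (Γ : GroupGrading F G (UT b)) : Prop :=
  ∃ γ : ι → G, ∀ (i j : ι) (h : i ≤ j),
    (⟨matrixUnit b i j, matrixUnit_mem_UT b h⟩ : UT b) ∈ Γ.comp ((γ i)⁻¹ * γ j)

/-- The grading `Γ` on `UT_β V` is the extension of the grading `Γ₀` on the dense subalgebra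
`UT_{→β} V`: its projections are continuous and extend the projections of `Γ₀`. -/
structure IsExtension (b : Module.Basis ι F V) (Γ₀ : GroupGrading F G (UTlim b))
    (Γ : GroupGrading F G (UT b)) : Prop where
  continuous_proj : ∀ g : G, @Continuous _ _ (topologyUT b) (topologyUT b) (Γ.proj g)
  proj_incl : ∀ (g : G) (t : UTlim b), Γ.proj g (incl b t) = incl b (Γ₀.proj g t)

end

end TriangularGrading

/-! Write `I_n` for `rowIdeal b n`, the triangular endomorphisms with rows `n, n + 1, …` zero. On
`I_{n+1} / I_n` an element `x` acts from the left as the scalar `diagEntry b n x`. This single fact,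
`mul_sub_smul_mem_rowZero`, drives both halves.

Part 1. By induction every `I_n` is graded (`proj_mem_rowIdeal`). If `I_n` is graded, comparing
components modulo `I_n` shows that the `n`-th diagonal entry vanishes on every component of degree
other than `1`; then multiplication by the components of `e_{ii}`, `i > n`, shows that `I_{n+1}` is
graded. The degree-`1` components of the `e_{nn}` therefore have the same diagonals as the `e_{nn}`,
and they are corrected recursively to orthogonal idempotents of degree `1` (`homIdem`). A
unitriangular element conjugates these to the `e_{nn}`. Once the `e_{nn}` have degree `1`, each line
`F e_{ij} = e_{ii} UT e_{jj}` is graded, so all `e_{ij}` are homogeneous and the projections just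
select matrix entries. Continuity and uniqueness of the extension follow; finite support follows
from applying the projections to the element whose entries on and above the diagonal are all `1`.

Part 2. An algebra automorphism preserves the `I_n` and the diagonal entries, so the image of
`e_{0j}` has a nonzero `(0, j)` entry (`entry_zero_ne_zero_of_multiplicative`). If the automorphism
is graded, the degree `η(j)` of `e_{0j}` must then equal `η'(j)`. -/

namespace TriangularGrading

/-! ### Projections of a group grading -/

namespace GroupGrading

variable {F G A B : Type*} [Field F] [Group G] [NonUnitalRing A] [Module F A]
  [NonUnitalRing B] [Module F B]

theorem iSup_comp (Γ : GroupGrading F G A) : ⨆ g, Γ.comp g = ⊤ := by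
  classical
  exact (DirectSum.isInternal_submodule_iff_iSupIndep_and_iSup_eq_top _).1 Γ.isInternal |>.2

@[elab_as_elim]
theorem homogeneous_induction (Γ : GroupGrading F G A) {motive : A → Prop} (x : A)
    (mem : ∀ g, ∀ y ∈ Γ.comp g, motive y) (zero : motive 0)
    (add : ∀ y z, motive y → motive z → motive (y + z)) : motive x :=
  Submodule.iSup_induction Γ.comp (motive := motive) (x := x)
    (by rw [Γ.iSup_comp]; exact Submodule.mem_top) mem zero add

theorem proj_mem (Γ : GroupGrading F G A) (g : G) (x : A) : Γ.proj g x ∈ Γ.comp g := by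
  simp [proj]

theorem proj_of_mem (Γ : GroupGrading F G A) {g : G} {x : A} (hx : x ∈ Γ.comp g) :
    Γ.proj g x = x := by
  let _ := Classical.decEq G
  have h : (LinearEquiv.ofBijective (DirectSum.coeLinearMap Γ.comp) Γ.isInternal).symm x =
      DirectSum.lof F G (fun h => Γ.comp h) g ⟨x, hx⟩ := by
    rw [LinearEquiv.symm_apply_eq]
    exact (DirectSum.coeLinearMap_lof Γ.comp g ⟨x, hx⟩).symm
  simp only [proj, LinearMap.comp_apply, LinearEquiv.coe_coe]
  rw [h, DirectSum.component.lof_self]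
  rfl

theorem proj_of_mem_of_ne (Γ : GroupGrading F G A) {g h : G} {x : A} (hx : x ∈ Γ.comp g)
    (hne : g ≠ h) : Γ.proj h x = 0 := by
  let _ := Classical.decEq G
  have e : (LinearEquiv.ofBijective (DirectSum.coeLinearMap Γ.comp) Γ.isInternal).symm x =
      DirectSum.lof F G (fun h => Γ.comp h) g ⟨x, hx⟩ := by
    rw [LinearEquiv.symm_apply_eq]
    exact (DirectSum.coeLinearMap_lof Γ.comp g ⟨x, hx⟩).symm
  simp only [proj, LinearMap.comp_apply, LinearEquiv.coe_coe]
  rw [e, DirectSum.component.of, dif_neg hne]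
  rfl

theorem exists_sum_proj (Γ : GroupGrading F G A) (x : A) :
    ∃ s : Finset G, (∀ g ∉ s, Γ.proj g x = 0) ∧ x = ∑ g ∈ s, Γ.proj g x := by
  classical
  induction x using Γ.homogeneous_induction with
  | mem g y hy =>
    refine ⟨{g}, fun h hh => Γ.proj_of_mem_of_ne hy ?_, ?_⟩
    · simpa [eq_comm] using hh
    · simp [Γ.proj_of_mem hy]
  | zero => exact ⟨∅, by simp, by simp⟩
  | add y z hy hz =>
    obtain ⟨s, hs, hy⟩ := hy
    obtain ⟨t, ht, hz⟩ := hz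
    refine ⟨s ∪ t, fun g hg => ?_, ?_⟩
    · rw [Finset.notMem_union] at hg
      rw [map_add, hs g hg.1, ht g hg.2, add_zero]
    · simp only [map_add, Finset.sum_add_distrib]
      rw [← Finset.sum_subset Finset.subset_union_left (fun g _ hg => hs g hg), ← hy,
        ← Finset.sum_subset Finset.subset_union_right (fun g _ hg => ht g hg), ← hz]

theorem exists_proj_ne_zero (Γ : GroupGrading F G A) {x : A} (hx : x ≠ 0) :
    ∃ g, Γ.proj g x ≠ 0 := by
  by_contra! h
  obtain ⟨s, -, hs⟩ := Γ.exists_sum_proj x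
  exact hx (by rw [hs, Finset.sum_eq_zero fun g _ => h g])

theorem finite_proj_ne_zero (Γ : GroupGrading F G A) (x : A) :
    {g | Γ.proj g x ≠ 0}.Finite := by
  obtain ⟨s, hs, -⟩ := Γ.exists_sum_proj x
  refine s.finite_toSet.subset fun g hg => ?_
  by_contra hgs
  exact hg (hs g hgs)

/-- A subspace containing all components of `x` contains `x`. -/
theorem mem_of_proj_mem (Γ : GroupGrading F G A) (W : AddSubmonoid A) {x : A}
    (h : ∀ g, Γ.proj g x ∈ W) : x ∈ W := by
  obtain ⟨s, -, hs⟩ := Γ.exists_sum_proj x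
  rw [hs]
  exact sum_mem fun g _ => h g

theorem eq_of_mem_comp (Γ : GroupGrading F G A) {g h : G} {x : A} (hx : x ≠ 0)
    (hg : x ∈ Γ.comp g) (hh : x ∈ Γ.comp h) : g = h := by
  by_contra hne
  exact hx (by rw [← Γ.proj_of_mem hh, Γ.proj_of_mem_of_ne hg hne])

/-- Left translation by `g` is injective on `G`, so only the component of `y` of degree `h` can
contribute in degree `g * h`. -/
theorem proj_mul_of_mem_left (Γ : GroupGrading F G A) {g : G} {x : A} (hx : x ∈ Γ.comp g)
    (h : G) (y : A) : Γ.proj (g * h) (x * y) = x * Γ.proj h y := by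
  induction y using Γ.homogeneous_induction with
  | mem k y hy =>
    by_cases hk : k = h
    · subst hk
      rw [Γ.proj_of_mem hy, Γ.proj_of_mem (Γ.mul_mem _ _ _ _ hx hy)]
    · rw [Γ.proj_of_mem_of_ne hy hk, mul_zero,
        Γ.proj_of_mem_of_ne (Γ.mul_mem _ _ _ _ hx hy) (by simpa using hk)]
  | zero => simp
  | add y z hy hz => rw [mul_add, map_add, map_add, mul_add, hy, hz]

theorem proj_mul_of_mem_right (Γ : GroupGrading F G A) {g : G} {y : A} (hy : y ∈ Γ.comp g)
    (h : G) (x : A) : Γ.proj (h * g) (x * y) = Γ.proj h x * y := by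
  induction x using Γ.homogeneous_induction with
  | mem k x hx =>
    by_cases hk : k = h
    · subst hk
      rw [Γ.proj_of_mem hx, Γ.proj_of_mem (Γ.mul_mem _ _ _ _ hx hy)]
    · rw [Γ.proj_of_mem_of_ne hx hk, zero_mul,
        Γ.proj_of_mem_of_ne (Γ.mul_mem _ _ _ _ hx hy) (by simpa using hk)]
  | zero => simp
  | add x z hx hz => rw [add_mul, map_add, map_add, add_mul, hx, hz]

/-- Transport of a grading along an isomorphism of algebras. -/
def map (Γ : GroupGrading F G A) (f : A ≃ₗ[F] B) (hf : ∀ x y, f (x * y) = f x * f y) :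
    GroupGrading F G B where
  comp g := (Γ.comp g).map f.toLinearMap
  isInternal := by
    let _ := Classical.decEq G
    have h := (DirectSum.isInternal_submodule_iff_iSupIndep_and_iSup_eq_top _).1 Γ.isInternal
    refine (DirectSum.isInternal_submodule_iff_iSupIndep_and_iSup_eq_top _).2 ⟨?_, ?_⟩
    · exact h.1.map_orderIso (Submodule.orderIsoMapComap f)
    · rw [← Submodule.map_iSup, h.2, Submodule.map_top, LinearEquiv.range]
  mul_mem := by
    rintro g h _ _ ⟨x, hx, rfl⟩ ⟨y, hy, rfl⟩
    exact ⟨x * y, Γ.mul_mem g h x y hx hy, hf x y⟩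

end GroupGrading

/-! ### Matrix entries and the filtration by rows -/

variable {F V ι : Type*} [Field F] [AddCommGroup V] [Module F V]

/-- The matrix entry of `t` in row `i` and column `j`. -/
noncomputable def entry (b : Module.Basis ι F V) (i j : ι) : Module.End F V →ₗ[F] F :=
  b.coord i ∘ₗ LinearMap.applyₗ (b j)

theorem entry_apply (b : Module.Basis ι F V) (i j : ι) (t : Module.End F V) :
    entry b i j t = b.repr (t (b j)) i := rfl

theorem matrixUnit_apply (b : Module.Basis ι F V) (i j : ι) (v : V) :
    matrixUnit b i j v = b.repr v j • b i := rfl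

theorem ext_entry (b : Module.Basis ι F V) {s t : Module.End F V}
    (h : ∀ i j, entry b i j s = entry b i j t) : s = t := ext_entries b h

theorem entry_matrixUnit_mul_self (b : Module.Basis ι F V) (i j k : ι) (t : Module.End F V) :
    entry b i j (matrixUnit b i k * t) = entry b k j t := by
  simp [entry_apply, matrixUnit_apply]

theorem entry_matrixUnit_mul_of_ne (b : Module.Basis ι F V) {i l : ι} (h : l ≠ i) (j k : ι)
    (t : Module.End F V) : entry b l j (matrixUnit b i k * t) = 0 := by
  simp [entry_apply, matrixUnit_apply, h.symm]

theorem entry_matrixUnit_self (b : Module.Basis ι F V) (i j : ι) :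
    entry b i j (matrixUnit b i j) = 1 := by
  simp [entry_apply, matrixUnit_apply]

theorem entry_matrixUnit_of_ne_left (b : Module.Basis ι F V) {i l : ι} (h : l ≠ i) (j k : ι) :
    entry b l k (matrixUnit b i j) = 0 := by
  simp [entry_apply, matrixUnit_apply, h.symm]

theorem entry_matrixUnit_of_ne_right (b : Module.Basis ι F V) {j k : ι} (h : k ≠ j) (i l : ι) :
    entry b l k (matrixUnit b i j) = 0 := by
  simp [entry_apply, matrixUnit_apply, h]

theorem matrixUnit_mul_mul_matrixUnit (b : Module.Basis ι F V) (i j k l : ι)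
    (t : Module.End F V) :
    matrixUnit b i j * t * matrixUnit b k l = entry b j k t • matrixUnit b i l := by
  refine b.ext fun m => ?_
  simp [entry_apply, matrixUnit_apply, smul_smul, mul_comm]

theorem matrixUnit_ne_zero (b : Module.Basis ι F V) (i j : ι) : matrixUnit b i j ≠ 0 := by
  intro h
  have := entry_matrixUnit_self b i j
  simp [h] at this

theorem mem_UT_iff [LinearOrder ι] {b : Module.Basis ι F V} {t : Module.End F V} :
    t ∈ UT b ↔ ∀ i j, j < i → entry b i j t = 0 := by
  have h : t ∈ UT b ↔ ∀ j, t (b j) ∈ Submodule.span F (b '' Set.Iic j) := Iff.rfl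
  simp only [h, Module.Basis.mem_span_image]
  constructor
  · intro h i j hij
    by_contra hne
    exact absurd (h j (Finsupp.mem_support_iff.2 hne)) (by simpa using hij)
  · intro h j i hi
    by_contra hlt
    exact Finsupp.mem_support_iff.1 hi (h i j (by simpa using hlt))

section Nat

variable {b : Module.Basis ℕ F V}

/-- Column `j` of `t` lives in rows `≤ j`, so the sum is finite whatever `s` is. -/
theorem entry_mul (b : Module.Basis ℕ F V) {s t : Module.End F V} (ht : t ∈ UT b) (i j : ℕ) :
    entry b i j (s * t) = ∑ k ∈ Finset.range (j + 1), entry b i k s * entry b k j t := by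
  have h : t (b j) = ∑ k ∈ Finset.range (j + 1), entry b k j t • b k := by
    conv_lhs => rw [← b.linearCombination_repr (t (b j)), Finsupp.linearCombination_apply,
      Finsupp.sum]
    refine Finset.sum_subset (fun k hk => ?_) fun k _ hk => ?_
    · by_contra hlt
      refine Finsupp.mem_support_iff.1 hk (mem_UT_iff.1 ht k j ?_)
      simpa using hlt
    · rw [Finsupp.notMem_support_iff.1 hk, zero_smul]
  rw [entry_apply, Module.End.mul_apply, h]
  simp [entry_apply, mul_comm]

theorem entry_mul_self {s t : Module.End F V} (hs : s ∈ UT b) (ht : t ∈ UT b) (i : ℕ) :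
    entry b i i (s * t) = entry b i i s * entry b i i t := by
  rw [entry_mul b ht]
  refine Finset.sum_eq_single i (fun k hk hne => ?_) (fun h => absurd (by simp) h)
  rw [mem_UT_iff.1 hs i k (by simp at hk; omega), zero_mul]

/-- The endomorphisms whose rows `n, n + 1, …` vanish. -/
def rowZero (b : Module.Basis ℕ F V) (n : ℕ) : Submodule F (Module.End F V) where
  carrier := {t | ∀ i j, n ≤ i → entry b i j t = 0}
  add_mem' hs ht i j h := by rw [map_add, hs i j h, ht i j h, add_zero]
  zero_mem' _ _ _ := map_zero _
  smul_mem' c t ht i j h := by rw [map_smul, ht i j h, smul_zero]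

theorem rowZero_mono {m n : ℕ} (h : m ≤ n) : rowZero b m ≤ rowZero b n :=
  fun _ ht i j hi => ht i j (h.trans hi)

theorem rowZero_zero : rowZero b 0 = ⊥ := by
  rw [eq_bot_iff]
  intro t ht
  exact ext_entry b fun i j => by rw [ht i j (Nat.zero_le _), map_zero]

theorem mul_mem_rowZero_left {n : ℕ} {s t : Module.End F V} (hs : s ∈ UT b) (ht : t ∈ UT b)
    (h : t ∈ rowZero b n) : s * t ∈ rowZero b n := fun i j hi => by
  rw [entry_mul b ht]
  refine Finset.sum_eq_zero fun k _ => ?_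
  rcases lt_or_ge k i with hk | hk
  · rw [mem_UT_iff.1 hs i k hk, zero_mul]
  · rw [h k j (hi.trans hk), mul_zero]

/-- Modulo `rowZero b n`, a triangular endomorphism acts on `rowZero b (n + 1)` from the left
as its `n`-th diagonal entry. -/
theorem mul_sub_smul_mem_rowZero {n : ℕ} {s t : Module.End F V} (hs : s ∈ UT b) (ht : t ∈ UT b)
    (h : t ∈ rowZero b (n + 1)) : s * t - entry b n n s • t ∈ rowZero b n := fun i j hi => by
  rcases hi.eq_or_lt with rfl | hi
  · rw [map_sub, map_smul, smul_eq_mul, sub_eq_zero, entry_mul b ht]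
    refine Finset.sum_eq_single n (fun k _ hne => ?_) fun hn => ?_
    · rcases hne.lt_or_gt with hk | hk
      · rw [mem_UT_iff.1 hs n k hk, zero_mul]
      · rw [h k j hk, mul_zero]
    · rw [mem_UT_iff.1 ht n j (by simpa using hn), mul_zero]
  · rw [map_sub, map_smul, mul_mem_rowZero_left hs ht h i j hi, h i j hi, smul_zero, sub_zero]

theorem matrixUnit_mem_rowZero (b : Module.Basis ℕ F V) {i n : ℕ} (h : i < n) (j : ℕ) :
    matrixUnit b i j ∈ rowZero b n :=
  fun _ _ hk => entry_matrixUnit_of_ne_left b (h.trans_le hk).ne' _ _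

end Nat

end TriangularGrading

namespace TriangularGrading

/-! ### Matrix units, diagonal entries and row ideals in `UT_β V` -/

variable {F V G : Type*} [Field F] [AddCommGroup V] [Module F V] [Group G]
  {b : Module.Basis ℕ F V}

/-- The matrix unit `e_{ij}`, `i ≤ j`, as an element of `UT_β V`. -/
noncomputable def unitUT (b : Module.Basis ℕ F V) {i j : ℕ} (h : i ≤ j) : UT b :=
  ⟨matrixUnit b i j, matrixUnit_mem_UT b h⟩

theorem unitUT_ne_zero (b : Module.Basis ℕ F V) {i j : ℕ} (h : i ≤ j) : unitUT b h ≠ 0 :=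
  fun h0 => matrixUnit_ne_zero b i j (congrArg Subtype.val h0)

theorem unitUT_mul (b : Module.Basis ℕ F V) {i j k : ℕ} (hij : i ≤ j) (hjk : j ≤ k) :
    unitUT b hij * unitUT b hjk = unitUT b (hij.trans hjk) :=
  Subtype.ext (matrixUnit_mul_same b i j k)

theorem unitUT_mul_mul_unitUT (b : Module.Basis ℕ F V) {i j : ℕ} (h : i ≤ j) (x : UT b) :
    unitUT b (le_refl i) * x * unitUT b (le_refl j) = entry b i j x.1 • unitUT b h :=
  Subtype.ext (matrixUnit_mul_mul_matrixUnit b i i j j x.1)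

/-- The diagonal entries as linear functionals on `UT_β V`. -/
noncomputable def diagEntry (b : Module.Basis ℕ F V) (n : ℕ) : UT b →ₗ[F] F :=
  entry b n n ∘ₗ (UT b).val.toLinearMap

theorem diagEntry_apply (b : Module.Basis ℕ F V) (n : ℕ) (x : UT b) :
    diagEntry b n x = entry b n n x.1 := rfl

theorem diagEntry_mul (b : Module.Basis ℕ F V) (n : ℕ) (x y : UT b) :
    diagEntry b n (x * y) = diagEntry b n x * diagEntry b n y :=
  entry_mul_self x.2 y.2 n

/-- The ideal of `UT_β V` of elements whose rows `n, n + 1, …` vanish. -/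
noncomputable def rowIdeal (b : Module.Basis ℕ F V) (n : ℕ) : Submodule F (UT b) :=
  (rowZero b n).comap (UT b).val.toLinearMap

theorem mem_rowIdeal {n : ℕ} {x : UT b} : x ∈ rowIdeal b n ↔ x.1 ∈ rowZero b n := Iff.rfl

theorem rowIdeal_mono {m n : ℕ} (h : m ≤ n) : rowIdeal b m ≤ rowIdeal b n :=
  fun _ hx => rowZero_mono h hx

theorem mul_mem_rowIdeal_left {n : ℕ} (x : UT b) {y : UT b} (h : y ∈ rowIdeal b n) :
    x * y ∈ rowIdeal b n := mul_mem_rowZero_left x.2 y.2 h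

theorem mul_sub_smul_mem_rowIdeal {n : ℕ} (x : UT b) {y : UT b} (h : y ∈ rowIdeal b (n + 1)) :
    x * y - diagEntry b n x • y ∈ rowIdeal b n := mul_sub_smul_mem_rowZero x.2 y.2 h

theorem unitUT_mem_rowIdeal (b : Module.Basis ℕ F V) {i j n : ℕ} (hij : i ≤ j) (h : i < n) :
    unitUT b hij ∈ rowIdeal b n := matrixUnit_mem_rowZero b h j

theorem diagEntry_eq_zero {n : ℕ} {x : UT b} (hx : x ∈ rowIdeal b n) : diagEntry b n x = 0 :=
  hx n n le_rfl

theorem diagEntry_unitUT_self (b : Module.Basis ℕ F V) (n : ℕ) :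
    diagEntry b n (unitUT b (le_refl n)) = 1 := entry_matrixUnit_self b n n

theorem diagEntry_unitUT_of_ne {i j n : ℕ} (hij : i ≤ j) (h : n ≠ i) :
    diagEntry b n (unitUT b hij) = 0 := entry_matrixUnit_of_ne_left b h _ _

/-! ### The row ideals are graded -/

theorem exists_diagEntry_proj_ne_zero (Γ : GroupGrading F G (UT b)) (n : ℕ) :
    ∃ g, diagEntry b n (Γ.proj g (unitUT b (le_refl n))) ≠ 0 := by
  by_contra! h0
  have := Γ.mem_of_proj_mem (LinearMap.ker (diagEntry b n)).toAddSubmonoid h0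
  have h1 : diagEntry b n (unitUT b (le_refl n)) = 0 := this
  rw [diagEntry_unitUT_self] at h1
  exact one_ne_zero h1

/-- If a diagonal entry does not vanish on the component of degree `s`, then left multiplication
by `s` preserves the diagonal entry of the components of `e_{nn}`. -/
theorem diagEntry_proj_mul (Γ : GroupGrading F G (UT b)) {n : ℕ}
    (hn : ∀ x ∈ rowIdeal b n, ∀ g, Γ.proj g x ∈ rowIdeal b n) {s : G} {x : UT b}
    (hx : x ∈ Γ.comp s) (hx0 : diagEntry b n x ≠ 0) (g : G) :
    diagEntry b n (Γ.proj (s * g) (unitUT b (le_refl n))) =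
      diagEntry b n (Γ.proj g (unitUT b (le_refl n))) := by
  -- Modulo the graded ideal `rowIdeal b n`, `x * e_{nn}` is a scalar multiple of `e_{nn}`; the
  -- components of degree `s * g` are compared.
  have h := hn _ (mul_sub_smul_mem_rowIdeal x
    (unitUT_mem_rowIdeal b (le_refl n) (Nat.lt_succ_self n))) (s * g)
  rw [map_sub, map_smul, Γ.proj_mul_of_mem_left hx] at h
  have h' := diagEntry_eq_zero h
  rw [map_sub, map_smul, diagEntry_mul, smul_eq_mul, ← mul_sub] at h'
  exact (sub_eq_zero.1 ((mul_eq_zero.1 h').resolve_left hx0)).symm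

/-- The degrees on which the `n`-th diagonal entry does not vanish form a finite set `S` closed
under multiplication, so left invariance of `β` under `S` makes `β` constant on `S`. As `β` vanishes
off `S`, it is right invariant too, which moves a homogeneous factor `a` out of the projection. -/
theorem diagEntry_proj_unitUT_mul (Γ : GroupGrading F G (UT b)) {n : ℕ}
    (hn : ∀ x ∈ rowIdeal b n, ∀ g, Γ.proj g x ∈ rowIdeal b n) (h : G) (a : UT b) :
    diagEntry b n (Γ.proj h (unitUT b (le_refl n) * a)) =
      diagEntry b n a * diagEntry b n (Γ.proj h (unitUT b (le_refl n))) := by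
  set β : G → F := fun g => diagEntry b n (Γ.proj g (unitUT b (le_refl n))) with hβ
  set S : Set G := {s | ∃ x ∈ Γ.comp s, diagEntry b n x ≠ 0} with hS
  have hinv : ∀ s ∈ S, ∀ g, β (s * g) = β g := fun s ⟨x, hx, hx0⟩ g =>
    diagEntry_proj_mul Γ hn hx hx0 g
  have hsupp : ∀ g, β g ≠ 0 → g ∈ S := fun g hg => ⟨_, Γ.proj_mem g _, hg⟩
  have hmul : ∀ s ∈ S, ∀ t ∈ S, s * t ∈ S := by
    rintro s ⟨x, hx, hx0⟩ t ⟨y, hy, hy0⟩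
    exact ⟨x * y, Γ.mul_mem _ _ _ _ hx hy, by rw [diagEntry_mul]; exact mul_ne_zero hx0 hy0⟩
  obtain ⟨g₀, hg₀⟩ : ∃ g, β g ≠ 0 := exists_diagEntry_proj_ne_zero Γ n
  -- Left invariance puts `S * g₀` inside the finite set of degrees of the components of `e_{nn}`.
  have hfin : S.Finite := by
    have hsub : (fun s => s * g₀) '' S ⊆ {g | Γ.proj g (unitUT b (le_refl n)) ≠ 0} := by
      rintro _ ⟨s, hs, rfl⟩ h0
      apply hg₀
      rw [← hinv s hs g₀]
      change diagEntry b n (Γ.proj (s * g₀) _) = 0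
      rw [h0, map_zero]
    exact Set.Finite.of_finite_image ((Γ.finite_proj_ne_zero _).subset hsub)
      (mul_left_injective g₀).injOn
  have hconst : ∀ s ∈ S, β s = β 1 := fun s hs => by simpa using hinv s hs 1
  have hout : ∀ g, g ∉ S → β g = 0 := fun g hg => by_contra fun h => hg (hsupp g h)
  have hright : ∀ s ∈ S, ∀ g, β (g * s⁻¹) = β g := by
    intro s hs g
    have hmem : g * s⁻¹ ∈ S ↔ g ∈ S := by
      constructor
      · intro h
        simpa using hmul _ h s hs
      · intro h
        -- Right translation by `s` maps the finite set `S` injectively into itself, hence onto.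
        have himage : (· * s) '' S = S :=
          Set.eq_of_subset_of_ncard_le (Set.image_subset_iff.2 fun t ht => hmul t ht s hs)
            (Set.ncard_image_of_injective S (mul_left_injective s)).ge hfin
        obtain ⟨t, ht, rfl⟩ := himage.ge h
        simpa using ht
    by_cases h : g ∈ S
    · rw [hconst _ h, hconst _ (hmem.2 h)]
    · rw [hout _ h, hout _ (fun h' => h (hmem.1 h'))]
  induction a using Γ.homogeneous_induction with
  | mem s y hy =>
    have h1 := Γ.proj_mul_of_mem_right hy (h * s⁻¹) (unitUT b (le_refl n))
    rw [inv_mul_cancel_right] at h1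
    rw [h1, diagEntry_mul, mul_comm]
    by_cases hy0 : diagEntry b n y = 0
    · rw [hy0, zero_mul, zero_mul]
    · congr 1
      exact hright s ⟨y, hy, hy0⟩ h
  | zero => simp
  | add y z hy hz => rw [mul_add, map_add, map_add, map_add, add_mul, hy, hz]

/-- A component `w` of `e_{nn}` with nonzero `n`-th diagonal entry lies in `rowIdeal b (n + 1)`, so
`x * w` is a scalar multiple of `w` modulo a graded ideal. For `s ≠ 1` the two sides have different
degrees, which forces the scalar to be `0`. -/
theorem diagEntry_eq_zero_of_mem_comp (Γ : GroupGrading F G (UT b)) {n : ℕ}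
    (hn : ∀ x ∈ rowIdeal b n, ∀ g, Γ.proj g x ∈ rowIdeal b n) {s : G} (hs : s ≠ 1) {x : UT b}
    (hx : x ∈ Γ.comp s) : diagEntry b n x = 0 := by
  obtain ⟨g, hg⟩ := exists_diagEntry_proj_ne_zero Γ n
  have hE := unitUT_mem_rowIdeal b (le_refl n) (Nat.lt_succ_self n)
  set w := Γ.proj g (unitUT b (le_refl n)) with hw
  have hw1 : w ∈ rowIdeal b (n + 1) := by
    intro i j hi
    have hni : n ≤ i := by omega
    -- This applies the preceding lemma to `e_{ni} = e_{nn} e_{ni}`, whose `n`-th diagonal entry is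
    -- `0` because `i > n`.
    have hK : ∀ h, diagEntry b n (Γ.proj h (unitUT b hni)) = 0 := fun h => by
      have := diagEntry_proj_unitUT_mul Γ hn h (unitUT b hni)
      rw [unitUT_mul] at this
      have h0 : diagEntry b n (unitUT b hni) = 0 :=
        entry_matrixUnit_of_ne_right b (by omega) _ _
      rw [this, h0, zero_mul]
    -- Row `n` of `e_{ni} * w` is row `i` of `w`, so this membership kills row `i`. Each component
    -- of `e_{ni}` carries `e_{nn}` into the graded ideal `rowIdeal b n`, and therefore also carries
    -- `w` there.
    have hL : unitUT b hni * w ∈ rowIdeal b n := by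
      refine Γ.mem_of_proj_mem
        ((rowIdeal b n).comap (LinearMap.mulRight F w)).toAddSubmonoid fun h => ?_
      change Γ.proj h _ * w ∈ rowIdeal b n
      rw [hw, ← Γ.proj_mul_of_mem_left (Γ.proj_mem h _)]
      refine hn _ ?_ _
      have := mul_sub_smul_mem_rowIdeal (Γ.proj h (unitUT b hni)) hE
      rwa [hK h, zero_smul, sub_zero] at this
    have := hL n j le_rfl
    exact (entry_matrixUnit_mul_self b n j i w.1).symm.trans this
  have h := hn _ (mul_sub_smul_mem_rowIdeal x hw1) g
  rw [map_sub, map_smul, Γ.proj_of_mem (Γ.proj_mem g _),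
    Γ.proj_of_mem_of_ne (Γ.mul_mem _ _ _ _ hx (Γ.proj_mem g _)) (by simpa using hs),
    zero_sub] at h
  have h' := diagEntry_eq_zero h
  rw [map_neg, map_smul, neg_eq_zero, smul_eq_mul] at h'
  exact (mul_eq_zero.1 h').resolve_right hg

theorem diagEntry_proj_one_of (Γ : GroupGrading F G (UT b)) {n : ℕ}
    (h : ∀ s ≠ 1, ∀ x ∈ Γ.comp s, diagEntry b n x = 0) (x : UT b) :
    diagEntry b n (Γ.proj 1 x) = diagEntry b n x := by
  induction x using Γ.homogeneous_induction with
  | mem s y hy =>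
    by_cases hs : s = 1
    · subst hs
      rw [Γ.proj_of_mem hy]
    · rw [Γ.proj_of_mem_of_ne hy hs, map_zero, h s hs y hy]
  | zero => simp
  | add y z hy hz => rw [map_add, map_add, map_add, hy, hz]

/-- The ideals `rowIdeal b n` are graded in every grading. -/
theorem proj_mem_rowIdeal (Γ : GroupGrading F G (UT b)) (n : ℕ) :
    ∀ x ∈ rowIdeal b n, ∀ g, Γ.proj g x ∈ rowIdeal b n := by
  induction n with
  | zero =>
    intro x hx g
    have h0 : x.1 = 0 := by simpa [mem_rowIdeal, rowZero_zero] using hx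
    have h1 : x = 0 := Subtype.ext h0
    rw [h1, map_zero]
    exact Submodule.zero_mem _
  | succ n hn =>
    intro x hx g i j hi
    have hdiag : ∀ s ≠ 1, ∀ x ∈ Γ.comp s, diagEntry b n x = 0 := fun s hs x hx =>
      diagEntry_eq_zero_of_mem_comp Γ hn hs hx
    have hE : ∀ h, diagEntry b n (Γ.proj h (unitUT b (le_refl i))) = 0 := fun h => by
      by_cases h1 : h = 1
      · rw [h1, diagEntry_proj_one_of Γ hdiag, diagEntry_unitUT_of_ne _ (by omega)]
      · exact hdiag h h1 _ (Γ.proj_mem h _)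
    -- Every component of `e_{ii}` has zero `n`-th diagonal entry, hence sends `x`, and by
    -- gradedness also `Γ.proj g x`, into `rowIdeal b n`.
    have hL : unitUT b (le_refl i) * Γ.proj g x ∈ rowIdeal b n := by
      refine Γ.mem_of_proj_mem
        ((rowIdeal b n).comap (LinearMap.mulRight F (Γ.proj g x))).toAddSubmonoid fun h => ?_
      change Γ.proj h _ * Γ.proj g x ∈ rowIdeal b n
      rw [← Γ.proj_mul_of_mem_left (Γ.proj_mem h _)]
      refine hn _ ?_ _
      have := mul_sub_smul_mem_rowIdeal (Γ.proj h (unitUT b (le_refl i))) hx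
      rwa [hE h, zero_smul, sub_zero] at this
    exact (entry_matrixUnit_mul_self b i j i (Γ.proj g x).1).symm.trans (hL i j (by omega))

/-- The homogeneous components of degree different from `1` are strictly triangular. -/
theorem diagEntry_proj_one (Γ : GroupGrading F G (UT b)) (n : ℕ) (x : UT b) :
    diagEntry b n (Γ.proj 1 x) = diagEntry b n x :=
  diagEntry_proj_one_of Γ (fun _ hs _ hx =>
    diagEntry_eq_zero_of_mem_comp Γ (proj_mem_rowIdeal Γ n) hs hx) x

/-! ### Orthogonal idempotents of degree `1` -/

/-- A sequence of homogeneous elements of degree `1`; the `n`-th one is a left identity of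
`rowIdeal b n`. -/
noncomputable def leftId (Γ : GroupGrading F G (UT b)) : ℕ → UT b
  | 0 => 0
  | n + 1 => leftId Γ n +
      (Γ.proj 1 (unitUT b (le_refl n)) - leftId Γ n * Γ.proj 1 (unitUT b (le_refl n)))

theorem leftId_mem_comp (Γ : GroupGrading F G (UT b)) (n : ℕ) : leftId Γ n ∈ Γ.comp 1 := by
  induction n with
  | zero => exact Submodule.zero_mem _
  | succ n ih =>
    refine Submodule.add_mem _ ih (Submodule.sub_mem _ (Γ.proj_mem 1 _) ?_)
    simpa using Γ.mul_mem 1 1 _ _ ih (Γ.proj_mem 1 (unitUT b (le_refl n)))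

theorem proj_one_unitUT_mem_rowIdeal (Γ : GroupGrading F G (UT b)) (n : ℕ) :
    Γ.proj 1 (unitUT b (le_refl n)) ∈ rowIdeal b (n + 1) :=
  proj_mem_rowIdeal Γ _ _ (unitUT_mem_rowIdeal b _ (Nat.lt_succ_self n)) 1

theorem leftId_mem_rowIdeal (Γ : GroupGrading F G (UT b)) (n : ℕ) :
    leftId Γ n ∈ rowIdeal b n := by
  induction n with
  | zero => exact Submodule.zero_mem _
  | succ n ih =>
    exact Submodule.add_mem _ (rowIdeal_mono n.le_succ ih)
      (Submodule.sub_mem _ (proj_one_unitUT_mem_rowIdeal Γ n)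
        (mul_mem_rowIdeal_left _ (proj_one_unitUT_mem_rowIdeal Γ n)))

/-- With `e` the degree-`1` component of `e_{nn}`, the recursion says `1 - leftId Γ (n + 1) = (1 -
leftId Γ n) * (1 - e)`. Since `e` has `n`-th diagonal entry `1`, the factor `1 - e` sends `rowIdeal
b (n + 1)` into `rowIdeal b n`, which `1 - leftId Γ n` kills. -/
theorem leftId_mul (Γ : GroupGrading F G (UT b)) (n : ℕ) :
    ∀ x ∈ rowIdeal b n, leftId Γ n * x = x := by
  induction n with
  | zero =>
    intro x hx
    have h0 : x.1 = 0 := by simpa [mem_rowIdeal, rowZero_zero] using hx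
    rw [show x = 0 from Subtype.ext h0, mul_zero]
  | succ n ih =>
    intro x hx
    have h := ih _ (mul_sub_smul_mem_rowIdeal (Γ.proj 1 (unitUT b (le_refl n))) hx)
    rw [diagEntry_proj_one, diagEntry_unitUT_self, one_smul, mul_sub, ← mul_assoc] at h
    rw [← sub_eq_zero] at h ⊢
    rw [leftId, add_mul, sub_mul, ← neg_eq_zero, ← h]
    abel

/-- Together with `leftId_mul_leftId_of_ge` this makes the `leftId` an increasing chain of commuting
idempotents, whose successive differences are orthogonal. -/
theorem leftId_mul_leftId (Γ : GroupGrading F G (UT b)) {m n : ℕ} (h : m ≤ n) :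
    leftId Γ m * leftId Γ n = leftId Γ m := by
  induction n, h using Nat.le_induction with
  | base => exact leftId_mul Γ m _ (leftId_mem_rowIdeal Γ m)
  | succ n _ ih => rw [leftId, mul_add, mul_sub, ← mul_assoc, ih, sub_self, add_zero]

/-- Orthogonal idempotents of degree `1` with the diagonals of the `e_{nn}`. -/
noncomputable def homIdem (Γ : GroupGrading F G (UT b)) (n : ℕ) : UT b :=
  leftId Γ (n + 1) - leftId Γ n

theorem homIdem_mem_comp (Γ : GroupGrading F G (UT b)) (n : ℕ) : homIdem Γ n ∈ Γ.comp 1 :=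
  Submodule.sub_mem _ (leftId_mem_comp Γ _) (leftId_mem_comp Γ _)

theorem leftId_mul_leftId_of_ge (Γ : GroupGrading F G (UT b)) {m n : ℕ} (h : n ≤ m) :
    leftId Γ m * leftId Γ n = leftId Γ n :=
  leftId_mul Γ m _ (rowIdeal_mono h (leftId_mem_rowIdeal Γ n))

theorem homIdem_mul_self (Γ : GroupGrading F G (UT b)) (n : ℕ) :
    homIdem Γ n * homIdem Γ n = homIdem Γ n := by
  simp only [homIdem, mul_sub, sub_mul]
  rw [leftId_mul_leftId Γ le_rfl, leftId_mul_leftId Γ le_rfl, leftId_mul_leftId Γ n.le_succ,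
    leftId_mul_leftId_of_ge Γ n.le_succ]
  abel

theorem homIdem_mul_of_ne (Γ : GroupGrading F G (UT b)) {m n : ℕ} (h : m ≠ n) :
    homIdem Γ m * homIdem Γ n = 0 := by
  simp only [homIdem, mul_sub, sub_mul]
  rcases h.lt_or_gt with h | h
  · rw [leftId_mul_leftId Γ (by omega : m + 1 ≤ n + 1), leftId_mul_leftId Γ (by omega : m ≤ n + 1),
      leftId_mul_leftId Γ (by omega : m + 1 ≤ n), leftId_mul_leftId Γ h.le, sub_self]
  · rw [leftId_mul_leftId_of_ge Γ (by omega : n + 1 ≤ m + 1),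
      leftId_mul_leftId_of_ge Γ (by omega : n + 1 ≤ m),
      leftId_mul_leftId_of_ge Γ (by omega : n ≤ m + 1), leftId_mul_leftId_of_ge Γ h.le]
    abel

theorem diagEntry_homIdem (Γ : GroupGrading F G (UT b)) (n : ℕ) :
    diagEntry b n (homIdem Γ n) = 1 := by
  rw [homIdem, leftId, add_sub_cancel_left, map_sub, diagEntry_proj_one, diagEntry_unitUT_self,
    diagEntry_mul, diagEntry_eq_zero (leftId_mem_rowIdeal Γ n), zero_mul, sub_zero]

/-! ### Conjugating the idempotents to the diagonal matrix units -/

/-- An upper triangular endomorphism with ones on the diagonal is invertible. -/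
theorem isUnit_of_diagEntry_eq_one {t : UT b} (ht : ∀ n, diagEntry b n t = 1) : IsUnit t := by
  have hIio : ∀ n : ℕ, Set.Iio (n + 1) = Set.Iic n := fun n =>
    Set.ext fun _ => Nat.lt_succ_iff
  have hlow : ∀ n, t.1 (b n) - b n ∈ Submodule.span F (b '' Set.Iio n) := fun n => by
    rw [Module.Basis.mem_span_image]
    intro i hi
    rw [Finset.mem_coe, Finsupp.mem_support_iff] at hi
    by_contra hlt
    rw [Set.mem_Iio] at hlt
    apply hi
    rw [map_sub, Finsupp.sub_apply, Module.Basis.repr_self]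
    rcases (not_lt.1 hlt).eq_or_lt with rfl | hlt
    · rw [Finsupp.single_eq_same, sub_eq_zero]
      exact ht n
    · rw [Finsupp.single_eq_of_ne hlt.ne', sub_zero]
      exact mem_UT_iff.1 t.2 i n hlt
  -- The preimage is found in the same initial span; this gives surjectivity and also makes the
  -- inverse triangular.
  have hspan : ∀ n, ∀ v ∈ Submodule.span F (b '' Set.Iio n),
      ∃ w ∈ Submodule.span F (b '' Set.Iio n), t.1 w = v := by
    intro n
    induction n with
    | zero =>
      intro v hv
      have : v = 0 := by simpa using hv
      exact ⟨0, Submodule.zero_mem _, by rw [this, map_zero]⟩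
    | succ n ih =>
      have hmono : Submodule.span F (b '' Set.Iio n) ≤ Submodule.span F (b '' Set.Iio (n + 1)) :=
        Submodule.span_mono (Set.image_mono (Set.Iio_subset_Iio n.le_succ))
      suffices h : Submodule.span F (b '' Set.Iio (n + 1)) ≤
          (Submodule.span F (b '' Set.Iio (n + 1))).map t.1 from fun v hv => h hv
      rw [Submodule.span_le]
      rintro _ ⟨i, hi, rfl⟩
      rcases (Nat.lt_succ_iff.1 hi).eq_or_lt with rfl | hi
      · obtain ⟨w, hw, hw'⟩ := ih _ (hlow i)
        exact ⟨b i - w, Submodule.sub_mem _ (Submodule.subset_span ⟨i, hi, rfl⟩) (hmono hw),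
          by rw [map_sub, hw', sub_sub_cancel]⟩
      · obtain ⟨w, hw, hw'⟩ := ih _ (Submodule.subset_span ⟨i, hi, rfl⟩)
        exact ⟨w, hmono hw, hw'⟩
  have hinj : Function.Injective t.1 := by
    rw [injective_iff_map_eq_zero]
    suffices h : ∀ n, ∀ v ∈ Submodule.span F (b '' Set.Iio n), t.1 v = 0 → v = 0 by
      intro v hv
      refine h ((b.repr v).support.sup id + 1) v ?_ hv
      rw [Module.Basis.mem_span_image]
      intro i hi
      exact Nat.lt_succ_of_le (Finset.le_sup (f := id) hi)
    intro n
    induction n with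
    | zero => intro v hv _; simpa using hv
    | succ n ih =>
      intro v hv hv0
      rw [hIio, ← Set.Iio_insert, Set.image_insert_eq,
        Submodule.mem_span_insert] at hv
      obtain ⟨a, w, hw, rfl⟩ := hv
      have htw : t.1 w ∈ Submodule.span F (b '' Set.Iio n) := by
        have hle : Submodule.span F (b '' Set.Iio n) ≤
            (Submodule.span F (b '' Set.Iio n)).comap t.1 := by
          rw [Submodule.span_le]
          rintro _ ⟨i, hi, rfl⟩
          exact Submodule.span_mono (Set.image_mono (Set.Iic_subset_Iio.2 hi)) (t.2 i)
        exact hle hw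
      have ha : a = 0 := by
        have h1 : a • b n ∈ Submodule.span F (b '' Set.Iio n) := by
          have h2 : a • b n = -(a • (t.1 (b n) - b n)) - t.1 w := by
            rw [map_add, map_smul] at hv0
            rw [smul_sub, eq_neg_of_add_eq_zero_right hv0]
            abel
          rw [h2]
          exact Submodule.sub_mem _ (Submodule.neg_mem _ (Submodule.smul_mem _ _ (hlow n))) htw
        rw [Module.Basis.mem_span_image] at h1
        by_contra ha
        have := h1 (show n ∈ ((b.repr (a • b n)).support : Set ℕ) by simpa using ha)
        exact lt_irrefl n this
      rw [ha, zero_smul, zero_add] at hv0 ⊢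
      exact ih w hw hv0
  have hsurj : Function.Surjective t.1 := by
    rw [← LinearMap.range_eq_top, ← top_le_iff, ← b.span_eq, Submodule.span_le]
    rintro _ ⟨n, rfl⟩
    obtain ⟨w, -, hw⟩ := hspan (n + 1) _ (Submodule.subset_span ⟨n, Nat.lt_succ_self n, rfl⟩)
    exact ⟨w, hw⟩
  let e := LinearEquiv.ofBijective t.1 ⟨hinj, hsurj⟩
  have he : ∀ v, e.symm (t.1 v) = v := fun v => e.symm_apply_apply v
  have he' : ∀ v, t.1 (e.symm v) = v := fun v => e.apply_symm_apply v
  have hs : (e.symm : V →ₗ[F] V) ∈ UT b := fun n => by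
    obtain ⟨w, hw, hw'⟩ := hspan (n + 1) (b n) (Submodule.subset_span ⟨n, Nat.lt_succ_self n, rfl⟩)
    rw [hIio] at hw
    rw [LinearEquiv.coe_coe, ← hw', he]
    exact hw
  exact ⟨⟨t, ⟨_, hs⟩, Subtype.ext (LinearMap.ext he'), Subtype.ext (LinearMap.ext he)⟩, rfl⟩

/-- Conjugation by a unit as a linear equivalence. -/
def conjEquiv {A : Type*} [Ring A] [Algebra F A] (u : Aˣ) : A ≃ₗ[F] A where
  toFun x := u⁻¹.1 * x * u.1
  invFun x := u.1 * x * u⁻¹.1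
  map_add' x y := by rw [mul_add, add_mul]
  map_smul' c x := by rw [mul_smul_comm, smul_mul_assoc]; rfl
  left_inv x := by simp [mul_assoc]
  right_inv x := by simp [mul_assoc]

theorem conjEquiv_apply {A : Type*} [Ring A] [Algebra F A] (u : Aˣ) (x : A) :
    conjEquiv (F := F) u x = u⁻¹.1 * x * u.1 := rfl

/-- Every grading of `UT_β V` is isomorphic to one in which all `e_{nn}` have degree `1`. -/
theorem exists_isomorphic_unitUT_mem (Γ : GroupGrading F G (UT b)) :
    ∃ Γ' : GroupGrading F G (UT b), Γ.IsIsomorphic Γ' ∧ (∀ g, Γ'.comp g = ⊥ → Γ.comp g = ⊥) ∧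
      ∀ n, unitUT b (le_refl n) ∈ Γ'.comp 1 := by
  -- Column `n` of `t` is column `n` of `homIdem Γ n`, so formally `t = ∑ homIdem Γ n * e_{nn}`. Its
  -- diagonal is `1`, and it intertwines `homIdem Γ n` with `e_{nn}`.
  let t : UT b := ⟨b.constr F fun n => (homIdem Γ n).1 (b n), fun n => by
    rw [Module.Basis.constr_basis]; exact (homIdem Γ n).2 n⟩
  have htb : ∀ n, t.1 (b n) = (homIdem Γ n).1 (b n) := fun n => b.constr_basis F _ n
  have htu : IsUnit t := isUnit_of_diagEntry_eq_one fun n => by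
    rw [← diagEntry_homIdem Γ n, diagEntry_apply, diagEntry_apply, entry_apply, entry_apply, htb]
  obtain ⟨u, hu⟩ := htu
  have hcomm : ∀ n, homIdem Γ n * t = t * unitUT b (le_refl n) := fun n => by
    refine Subtype.ext (b.ext fun m => ?_)
    change (homIdem Γ n).1 (t.1 (b m)) = t.1 (matrixUnit b n n (b m))
    rw [htb, ← Module.End.mul_apply, ← MulMemClass.coe_mul]
    by_cases h : m = n
    · subst h
      rw [homIdem_mul_self, matrixUnit_apply_self, htb]
    · rw [homIdem_mul_of_ne Γ (Ne.symm h), matrixUnit_apply_of_ne b n h, map_zero]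
      rfl
  have hmul : ∀ x y : UT b, conjEquiv (F := F) u (x * y) =
      conjEquiv (F := F) u x * conjEquiv (F := F) u y := by
    intro x y
    simp [conjEquiv_apply, mul_assoc]
  refine ⟨Γ.map (conjEquiv u) hmul, ⟨conjEquiv u, hmul, fun g x hx => ⟨x, hx, rfl⟩⟩,
    fun g hg => ?_, fun n => ⟨homIdem Γ n, homIdem_mem_comp Γ n, ?_⟩⟩
  · exact (Submodule.map_eq_bot_iff (e := conjEquiv u) (p := Γ.comp g)).1 hg
  · change u⁻¹.1 * homIdem Γ n * u.1 = _
    rw [mul_assoc, hu, hcomm, ← hu, Units.inv_mul_cancel_left]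

/-! ### Homogeneity and degrees of the matrix units -/

/-- If all `e_{nn}` have degree `1`, then every `e_{ij}` is homogeneous. -/
theorem exists_unitUT_mem_comp (Γ : GroupGrading F G (UT b))
    (h1 : ∀ n, unitUT b (le_refl n) ∈ Γ.comp 1) {i j : ℕ} (h : i ≤ j) :
    ∃ g, unitUT b h ∈ Γ.comp g := by
  obtain ⟨g, hg⟩ := Γ.exists_proj_ne_zero (unitUT_ne_zero b h)
  -- Multiplication by `e_{ii}` and `e_{jj}`, of degree `1`, commutes with the projection, so each
  -- component of `e_{ij}` stays in the line `e_{ii} UT e_{jj}`.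
  have key : Γ.proj g (unitUT b h) = entry b i j (Γ.proj g (unitUT b h)).1 • unitUT b h := by
    rw [← unitUT_mul_mul_unitUT b h]
    have hr := Γ.proj_mul_of_mem_right (h1 j) g (unitUT b (le_refl i) * unitUT b h)
    have hl := Γ.proj_mul_of_mem_left (h1 i) g (unitUT b h)
    rw [one_mul] at hl
    rw [mul_one, hl, unitUT_mul, unitUT_mul] at hr
    exact hr
  have hc : entry b i j (Γ.proj g (unitUT b h)).1 ≠ 0 := fun h0 => hg (by
    rw [key, h0, zero_smul])
  refine ⟨g, ?_⟩
  have hmem := Submodule.smul_mem _ (entry b i j (Γ.proj g (unitUT b h)).1)⁻¹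
    (Γ.proj_mem g (unitUT b h))
  rw [key, smul_smul] at hmem
  convert hmem using 1
  rw [← key, inv_mul_cancel₀ hc, one_smul]

/-- If all `e_{nn}` have degree `1`, then the grading is elementary. -/
theorem exists_degree_of_unitUT_mem (Γ : GroupGrading F G (UT b))
    (h1 : ∀ n, unitUT b (le_refl n) ∈ Γ.comp 1) :
    ∃ η : {i : ℕ // i ≠ 0} → G, ∀ (i j : ℕ) (h : i ≤ j),
      unitUT b h ∈ Γ.comp ((extendByOne η i)⁻¹ * extendByOne η j) := by
  choose d hd using fun i j (h : i ≤ j) => exists_unitUT_mem_comp Γ h1 h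
  -- The degree function is the degree of `e_{0i}`; at `0` the default value `1` is right because
  -- `e_{00}` has degree `1`. Then `e_{0i} e_{ij} = e_{0j}` determines the degree of `e_{ij}`.
  have hγ : ∀ i, unitUT b (Nat.zero_le i) ∈
      Γ.comp (extendByOne (fun i => d 0 i.1 (Nat.zero_le i.1)) i) := fun i => by
    by_cases hi : i = 0
    · subst hi
      simpa [extendByOne] using h1 0
    · simpa [extendByOne, hi] using hd 0 i (Nat.zero_le i)
  refine ⟨fun i => d 0 i.1 (Nat.zero_le i.1), fun i j h => ?_⟩
  have hmul := Γ.mul_mem _ _ _ _ (hγ i) (hd i j h)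
  rw [unitUT_mul] at hmul
  rw [← Γ.eq_of_mem_comp (unitUT_ne_zero b _) hmul (hγ j), inv_mul_cancel_left]
  exact hd i j h

/-! ### Elementary gradings: finite support, continuity, extensions -/

/-- In an elementary grading the projections select the entries of the given degree. -/
theorem entry_proj (Γ : GroupGrading F G (UT b)) {γ : ℕ → G}
    (hγ : ∀ (i j : ℕ) (h : i ≤ j), unitUT b h ∈ Γ.comp ((γ i)⁻¹ * γ j)) (g : G) (x : UT b)
    {i j : ℕ} (h : i ≤ j) [Decidable ((γ i)⁻¹ * γ j = g)] :
    entry b i j (Γ.proj g x).1 = if (γ i)⁻¹ * γ j = g then entry b i j x.1 else 0 := by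
  have h1 : ∀ n, unitUT b (le_refl n) ∈ Γ.comp 1 := fun n => by simpa using hγ n n le_rfl
  have key : entry b i j (Γ.proj g x).1 • unitUT b h =
      entry b i j x.1 • Γ.proj g (unitUT b h) := by
    have hr := Γ.proj_mul_of_mem_right (h1 j) g (unitUT b (le_refl i) * x)
    have hl := Γ.proj_mul_of_mem_left (h1 i) g x
    rw [one_mul] at hl
    rw [mul_one, hl, unitUT_mul_mul_unitUT b h, unitUT_mul_mul_unitUT b h, map_smul] at hr
    exact hr.symm
  split_ifs with hg
  · subst hg
    rw [Γ.proj_of_mem (hγ i j h), ← sub_eq_zero, ← sub_smul] at key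
    exact sub_eq_zero.1 ((smul_eq_zero.1 key).resolve_right (unitUT_ne_zero b h))
  · rw [Γ.proj_of_mem_of_ne (hγ i j h) hg, smul_zero] at key
    exact (smul_eq_zero.1 key).resolve_right (unitUT_ne_zero b h)

theorem ext_entry_UT {x y : UT b} (h : ∀ i j, i ≤ j → entry b i j x.1 = entry b i j y.1) :
    x = y := by
  refine Subtype.ext (ext_entry b fun i j => ?_)
  rcases le_or_gt i j with hij | hij
  · exact h i j hij
  · rw [mem_UT_iff.1 x.2 i j hij, mem_UT_iff.1 y.2 i j hij]

theorem eq_zero_of_mem_comp_of_forall_ne (Γ : GroupGrading F G (UT b)) {γ : ℕ → G}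
    (hγ : ∀ (i j : ℕ) (h : i ≤ j), unitUT b h ∈ Γ.comp ((γ i)⁻¹ * γ j)) {g : G} {x : UT b}
    (hx : x ∈ Γ.comp g) {i j : ℕ} (h : i ≤ j) (hne : (γ i)⁻¹ * γ j ≠ g) :
    entry b i j x.1 = 0 := by
  classical
  rw [← Γ.proj_of_mem hx, entry_proj Γ hγ g x h, if_neg hne]

/-- An elementary grading of `UT_β V` has finite support. -/
theorem finite_support_of_elementary (Γ : GroupGrading F G (UT b)) {γ : ℕ → G}
    (hγ : ∀ (i j : ℕ) (h : i ≤ j), unitUT b h ∈ Γ.comp ((γ i)⁻¹ * γ j)) :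
    Γ.support.Finite := by
  classical
  -- All entries of `x` on and above the diagonal are `1`, so `x` has a nonzero component in every
  -- degree of the support, yet only finitely many nonzero components.
  let x : UT b := ⟨b.constr F fun j => ∑ i ∈ Finset.range (j + 1), b i, fun j => by
    rw [Module.Basis.constr_basis]
    exact Submodule.sum_mem _ fun i hi => Submodule.subset_span
      ⟨i, Nat.lt_succ_iff.1 (Finset.mem_range.1 hi), rfl⟩⟩
  have hx : ∀ i j, i ≤ j → entry b i j x.1 = 1 := fun i j h => by
    have : x.1 (b j) = ∑ i ∈ Finset.range (j + 1), b i := b.constr_basis F _ j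
    rw [entry_apply, this]
    simp [Finsupp.single_apply, h]
  refine (Γ.finite_proj_ne_zero x).subset fun g hg => ?_
  obtain ⟨y, hy, hy0⟩ := (Submodule.ne_bot_iff _).1 hg
  obtain ⟨i, j, h, hij⟩ : ∃ i j, i ≤ j ∧ entry b i j y.1 ≠ 0 := by
    by_contra! h0
    exact hy0 (ext_entry_UT fun i j h => (h0 i j h).trans (map_zero _).symm)
  have hd : (γ i)⁻¹ * γ j = g := by
    by_contra hne
    exact hij (eq_zero_of_mem_comp_of_forall_ne Γ hγ hy h hne)
  intro h0
  have h1 := entry_proj Γ hγ g x h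
  rw [h0, if_pos hd, hx i j h] at h1
  exact zero_ne_one ((map_zero (entry b i j)).symm.trans h1)

/-- A vector involves finitely many basis vectors, and fixing finitely many columns is an open
condition in the finite topology. -/
theorem continuous_of_column_congr {f : UT b → UT b}
    (hf : ∀ x y : UT b, ∀ j, x.1 (b j) = y.1 (b j) → (f x).1 (b j) = (f y).1 (b j)) :
    @Continuous _ _ (topologyUT b) (topologyUT b) f := by
  let _ : TopologicalSpace V := ⊥
  have : DiscreteTopology V := ⟨rfl⟩
  let _ : TopologicalSpace (Module.End F V) := finiteTopology F V
  let _ : TopologicalSpace (UT b) := topologyUT b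
  have hcont : ∀ v : V, Continuous fun x : UT b => x.1 v := fun v =>
    (continuous_apply v).comp (continuous_induced_dom.comp continuous_induced_dom)
  refine continuous_induced_rng.2 (continuous_induced_rng.2 (continuous_pi fun v => ?_))
  refine IsLocallyConstant.continuous (IsLocallyConstant.iff_eventually_eq _ |>.2 fun x => ?_)
  have hev : ∀ j, ∀ᶠ y in nhds x, y.1 (b j) = x.1 (b j) := fun j =>
    (hcont (b j)).continuousAt.eventually (p := fun v => v = x.1 (b j))
      (by rw [nhds_discrete]; exact Filter.eventually_pure.2 rfl)
  filter_upwards [(Finset.eventually_all (b.repr v).support).2 fun j _ => hev j] with y hy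
  change (f y).1 v = (f x).1 v
  rw [← b.linearCombination_repr v, Finsupp.linearCombination_apply, Finsupp.sum, map_sum, map_sum]
  exact Finset.sum_congr rfl fun j hj => by rw [map_smul, map_smul, hf y x j (hy j hj)]

/-- An elementary grading of `UT_β V` extends that of `UT_{→β} V` with the same degrees. -/
theorem isExtension_of_elementary (Γ : GroupGrading F G (UT b)) {γ : ℕ → G}
    (hγ : ∀ (i j : ℕ) (h : i ≤ j), unitUT b h ∈ Γ.comp ((γ i)⁻¹ * γ j)) :
    IsExtension b (elementaryGrading b γ) Γ where
  continuous_proj g := by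
    classical
    refine continuous_of_column_congr fun x y j hxy => b.repr.injective (Finsupp.ext fun i => ?_)
    change entry b i j _ = entry b i j _
    rcases le_or_gt i j with hij | hij
    · rw [entry_proj Γ hγ g x hij, entry_proj Γ hγ g y hij, entry_apply, entry_apply, hxy]
    · rw [mem_UT_iff.1 (Γ.proj g x).2 i j hij, mem_UT_iff.1 (Γ.proj g y).2 i j hij]
  proj_incl g t := by
    have hincl : ∀ k, ∀ t ∈ (elementaryGrading b γ).comp k, incl b t ∈ Γ.comp k := by
      intro k t ht
      change t ∈ Submodule.span F _ at ht
      induction ht using Submodule.span_induction with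
      | mem t ht =>
        obtain ⟨i, j, hij, rfl, ht⟩ := ht
        rw [show incl b t = unitUT b hij from Subtype.ext ht]
        exact hγ i j hij
      | zero => exact Submodule.zero_mem _
      | add s t _ _ hs ht => exact Submodule.add_mem _ hs ht
      | smul c t _ ht => exact Submodule.smul_mem _ c ht
    have hadd : ∀ s t, incl b (s + t) = incl b s + incl b t := fun _ _ => rfl
    induction t using (elementaryGrading b γ).homogeneous_induction with
    | mem k t ht =>
      by_cases hk : k = g
      · subst hk
        rw [GroupGrading.proj_of_mem _ ht, GroupGrading.proj_of_mem _ (hincl k t ht)]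
      · rw [GroupGrading.proj_of_mem_of_ne _ ht hk,
          GroupGrading.proj_of_mem_of_ne _ (hincl k t ht) hk]
        rfl
    | zero => rw [map_zero]; exact map_zero _
    | add s t hs ht => rw [hadd, map_add, map_add, hadd, hs, ht]

theorem unitUT_mem_of_isExtension {Γ : GroupGrading F G (UT b)} {γ : ℕ → G}
    (hΓ : IsExtension b (elementaryGrading b γ) Γ) (i j : ℕ) (h : i ≤ j) :
    unitUT b h ∈ Γ.comp ((γ i)⁻¹ * γ j) := by
  have ht : (⟨matrixUnit b i j, matrixUnit_mem_UTlim b h⟩ : UTlim b) ∈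
      (elementaryGrading b γ).comp ((γ i)⁻¹ * γ j) := Submodule.subset_span ⟨i, j, h, rfl, rfl⟩
  have := hΓ.proj_incl ((γ i)⁻¹ * γ j) ⟨matrixUnit b i j, matrixUnit_mem_UTlim b h⟩
  rw [GroupGrading.proj_of_mem _ ht] at this
  rw [show unitUT b h = incl b ⟨matrixUnit b i j, matrixUnit_mem_UTlim b h⟩ from rfl, ← this]
  exact Γ.proj_mem _ _

/-- The extension of an elementary grading of `UT_{→β} V` is unique. -/
theorem comp_le_of_isExtension {Γ Γ' : GroupGrading F G (UT b)} {γ : ℕ → G}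
    (hΓ : IsExtension b (elementaryGrading b γ) Γ)
    (hΓ' : IsExtension b (elementaryGrading b γ) Γ') (g : G) : Γ.comp g ≤ Γ'.comp g := by
  classical
  intro x hx
  have h : Γ'.proj g x = x := by
    conv_rhs => rw [← Γ.proj_of_mem hx]
    refine ext_entry_UT fun i j hij => ?_
    rw [entry_proj Γ (unitUT_mem_of_isExtension hΓ) g x hij,
      entry_proj Γ' (unitUT_mem_of_isExtension hΓ') g x hij]
  rw [← h]
  exact Γ'.proj_mem g x

/-! ### Automorphisms

Here `φ` embeds an algebra `B` in `UT_β V` so that the image contains `UT_{→β} V`. -/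

section Automorphism

variable {B : Type*} [NonUnitalRing B] [Module F B] {φ : B →ₗ[F] Module.End F V}

/-- For `i > n`, the preimage of `e_{ni}` acts on `x` as a scalar `c` modulo `rowZero b n`; applying
`f`, so does `e_{ni}` on `f x`. Row `n` gives that row `i` of `f x` is `c` times row `n`, and row
`i` gives that `c` times row `i` is `0`; either way row `i` vanishes. -/
theorem mem_rowZero_of_multiplicative (hφ : ∀ x y, φ (x * y) = φ x * φ y)
    (hUT : ∀ x, φ x ∈ UT b) (hunit : ∀ i j, i ≤ j → ∃ x, φ x = matrixUnit b i j)
    (hinj : Function.Injective φ) (n : ℕ) :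
    ∀ f : B ≃ₗ[F] B, (∀ x y, f (x * y) = f x * f y) →
      ∀ x, φ x ∈ rowZero b n → φ (f x) ∈ rowZero b n := by
  induction n with
  | zero =>
    intro f _ x hx
    rw [rowZero_zero, Submodule.mem_bot] at hx ⊢
    rw [(map_eq_zero_iff φ hinj).1 hx, map_zero, map_zero]
  | succ n ih =>
    intro f hf x hx i j hi
    obtain ⟨e, he⟩ := hunit n i (by omega)
    have hfe : f (f.symm e * x) = e * f x := by rw [hf, f.apply_symm_apply]
    have h := mul_sub_smul_mem_rowZero (hUT (f.symm e)) (hUT x) hx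
    rw [← hφ, ← map_smul, ← map_sub] at h
    have h' := ih f hf _ h
    rw [map_sub, map_smul, hfe, map_sub, hφ, map_smul, he] at h'
    set c := entry b n n (φ (f.symm e))
    have hrow : ∀ l, n ≤ l → ∀ m, c * entry b l m (φ (f x)) =
        entry b l m (matrixUnit b n i * φ (f x)) := fun l hl m => by
      have := h' l m hl
      rw [map_sub, map_smul, smul_eq_mul] at this
      exact (sub_eq_zero.1 this).symm
    have h1 := hrow n le_rfl j
    rw [entry_matrixUnit_mul_self] at h1
    have h2 := hrow i (by omega) j
    rw [entry_matrixUnit_mul_of_ne b (by omega)] at h2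
    rcases mul_eq_zero.1 h2 with h0 | h0
    · rw [← h1, h0, zero_mul]
    · exact h0

/-- Modulo `rowZero b n`, `f x` acts on `f e`, the image of `e_{nn}`, both by the diagonal entry of
`x` and by that of `f x`. If these differed, `f e` would lie in `rowZero b n`, and applying `f.symm`
would put `e_{nn}` there. -/
theorem entry_self_of_multiplicative (hφ : ∀ x y, φ (x * y) = φ x * φ y)
    (hUT : ∀ x, φ x ∈ UT b) (hunit : ∀ i j, i ≤ j → ∃ x, φ x = matrixUnit b i j)
    (hinj : Function.Injective φ) (f : B ≃ₗ[F] B) (hf : ∀ x y, f (x * y) = f x * f y)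
    (n : ℕ) (x : B) : entry b n n (φ (f x)) = entry b n n (φ x) := by
  obtain ⟨e, he⟩ := hunit n n le_rfl
  have hmem : φ e ∈ rowZero b (n + 1) := by
    rw [he]
    exact matrixUnit_mem_rowZero b n.lt_succ_self n
  have h1 := mul_sub_smul_mem_rowZero (hUT x) (hUT e) hmem
  rw [← hφ, ← map_smul, ← map_sub] at h1
  have h2 := mem_rowZero_of_multiplicative hφ hUT hunit hinj n f hf _ h1
  have h3 := mul_sub_smul_mem_rowZero (hUT (f x)) (hUT (f e))
    (mem_rowZero_of_multiplicative hφ hUT hunit hinj (n + 1) f hf _ hmem)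
  rw [map_sub, map_smul, hf, map_sub, map_smul, hφ] at h2
  have h4 := Submodule.sub_mem _ h2 h3
  rw [sub_sub_sub_cancel_left, ← sub_smul] at h4
  by_contra hne
  have h5 := (Submodule.smul_mem_iff _ (sub_ne_zero.2 hne)).1 h4
  have hsymm : ∀ x y, f.symm (x * y) = f.symm x * f.symm y := fun x y => by
    rw [LinearEquiv.symm_apply_eq, hf, f.apply_symm_apply, f.apply_symm_apply]
  have h6 := mem_rowZero_of_multiplicative hφ hUT hunit hinj n f.symm hsymm _ h5
  rw [f.symm_apply_apply, he] at h6
  exact one_ne_zero ((entry_matrixUnit_self b n n).symm.trans (h6 n n le_rfl))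

/-- The image of `e_{0j}` is nonzero and has only row `0`. If its first nonzero column is `k`, then
`e_{0j} e_{jj} = e_{0j}` and preservation of diagonals make the `k`-th diagonal entry of `e_{jj}`
nonzero, so `k = j`. -/
theorem entry_zero_ne_zero_of_multiplicative (hφ : ∀ x y, φ (x * y) = φ x * φ y)
    (hUT : ∀ x, φ x ∈ UT b) (hunit : ∀ i j, i ≤ j → ∃ x, φ x = matrixUnit b i j)
    (hinj : Function.Injective φ) (f : B ≃ₗ[F] B) (hf : ∀ x y, f (x * y) = f x * f y)
    {j : ℕ} {x : B} (hx : φ x = matrixUnit b 0 j) : entry b 0 j (φ (f x)) ≠ 0 := by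
  classical
  have hrow : φ (f x) ∈ rowZero b 1 :=
    mem_rowZero_of_multiplicative hφ hUT hunit hinj 1 f hf x
      (by rw [hx]; exact matrixUnit_mem_rowZero b Nat.one_pos j)
  have hex : ∃ k, entry b 0 k (φ (f x)) ≠ 0 := by
    by_contra! h0
    have hfx : φ (f x) = 0 := ext_entry b fun i k => by
      rw [map_zero]
      rcases Nat.eq_zero_or_pos i with rfl | hi
      · exact h0 k
      · exact hrow i k hi
    rw [map_eq_zero_iff φ hinj, map_eq_zero_iff f f.injective] at hfx
    rw [hfx, map_zero] at hx
    exact matrixUnit_ne_zero b 0 j hx.symm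
  obtain ⟨e, he⟩ := hunit j j le_rfl
  have hxe : x * e = x := hinj (by rw [hφ, hx, he, matrixUnit_mul_same])
  have hne := Nat.find_spec hex
  have hmin : ∀ l < Nat.find hex, entry b 0 l (φ (f x)) = 0 := fun l hl =>
    not_not.1 (Nat.find_min hex hl)
  set k := Nat.find hex
  have hk : entry b 0 k (φ (f x)) = entry b 0 k (φ (f x)) * entry b k k (φ e) := by
    conv_lhs => rw [← hxe, hf, hφ, entry_mul b (hUT _)]
    rw [← entry_self_of_multiplicative hφ hUT hunit hinj f hf]
    refine Finset.sum_eq_single k (fun l hl hlk => ?_) fun h => absurd (by simp) h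
    rw [hmin l (by rw [Finset.mem_range] at hl; omega), zero_mul]
  by_cases hkj : k = j
  · rwa [hkj] at hne
  · rw [he, entry_matrixUnit_of_ne_left b hkj, mul_zero] at hk
    exact absurd hk hne

end Automorphism

theorem ext_of_extendByOne {η η' : {i : ℕ // i ≠ 0} → G}
    (h : ∀ j, (extendByOne η 0)⁻¹ * extendByOne η j = (extendByOne η' 0)⁻¹ * extendByOne η' j) :
    η = η' := by
  funext ⟨j, hj⟩
  simpa [extendByOne, hj] using h j

end TriangularGrading

/-! ### The classification theorem -/

theorem mainTheorem2 {F V G : Type*} [Field F] [AddCommGroup V] [Module F V] [Group G]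
    (b : Module.Basis ℕ F V) :
    (∀ Γ : TriangularGrading.GroupGrading F G (TriangularGrading.UT b),
      Γ.support.Finite ∧
      ∃ (η : {i : ℕ // i ≠ 0} → G)
        (Γ' : TriangularGrading.GroupGrading F G (TriangularGrading.UT b)),
        TriangularGrading.IsElementary b Γ' ∧
        TriangularGrading.IsExtension b
          (TriangularGrading.elementaryGrading b (TriangularGrading.extendByOne η)) Γ' ∧
        Γ.IsIsomorphic Γ') ∧
    (∀ (η η' : {i : ℕ // i ≠ 0} → G)
      (Γ Γ' : TriangularGrading.GroupGrading F G (TriangularGrading.UT b)),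
      TriangularGrading.IsExtension b
        (TriangularGrading.elementaryGrading b (TriangularGrading.extendByOne η)) Γ →
      TriangularGrading.IsExtension b
        (TriangularGrading.elementaryGrading b (TriangularGrading.extendByOne η')) Γ' →
      List.TFAE [
        Γ.IsIsomorphic Γ',
        (TriangularGrading.elementaryGrading b (TriangularGrading.extendByOne η)).IsIsomorphic
          (TriangularGrading.elementaryGrading b (TriangularGrading.extendByOne η')),
        η = η']) := by
  open TriangularGrading in
  refine ⟨fun Γ => ?_, fun η η' Γ Γ' hΓ hΓ' => ?_⟩
  · obtain ⟨Γ', hiso, hbot, h1⟩ := exists_isomorphic_unitUT_mem Γ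
    obtain ⟨η, hη⟩ := exists_degree_of_unitUT_mem Γ' h1
    exact ⟨(finite_support_of_elementary Γ' hη).subset fun g hg h0 => hg (hbot g h0),
      η, Γ', ⟨_, hη⟩, isExtension_of_elementary Γ' hη, hiso⟩
  tfae_have 1 → 3 := by
    rintro ⟨f, hf, hdeg⟩
    refine ext_of_extendByOne fun j => ?_
    by_contra hne
    -- The image of `e_{0j}` has degree `η(j)`, so its `(0, j)` entry would vanish if `η'(j)` were
    -- different.
    refine entry_zero_ne_zero_of_multiplicative (b := b) (φ := (UT b).val.toLinearMap)
      (fun _ _ => rfl) (fun x => x.2)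
      (fun i j h => ⟨unitUT b h, rfl⟩) Subtype.val_injective f hf
      (x := unitUT b (Nat.zero_le j)) rfl ?_
    exact eq_zero_of_mem_comp_of_forall_ne Γ' (unitUT_mem_of_isExtension hΓ')
      (hdeg _ _ (unitUT_mem_of_isExtension hΓ 0 j (Nat.zero_le j))) (Nat.zero_le j)
      (Ne.symm hne)
  tfae_have 2 → 3 := by
    rintro ⟨f, hf, hdeg⟩
    refine ext_of_extendByOne fun j => ?_
    by_contra hne
    refine entry_zero_ne_zero_of_multiplicative (b := b) (φ := (UTlim b).toSubmodule.subtype)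
      (fun _ _ => rfl) (fun x => UTlim_le_UT b x.2)
      (fun i j h => ⟨⟨_, matrixUnit_mem_UTlim b h⟩, rfl⟩) Subtype.val_injective f hf
      (x := ⟨_, matrixUnit_mem_UTlim b (Nat.zero_le j)⟩) rfl ?_
    exact entry_eq_zero_of_mem b _
      (hdeg _ _ (Submodule.subset_span ⟨0, j, Nat.zero_le j, rfl, rfl⟩)) (Ne.symm hne)
  tfae_have 3 → 1 := by
    rintro rfl
    exact ⟨LinearEquiv.refl F _, fun _ _ => rfl,
      fun g x hx => comp_le_of_isExtension hΓ hΓ' g hx⟩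
  tfae_have 3 → 2 := by
    rintro rfl
    exact ⟨LinearEquiv.refl F _, fun _ _ => rfl, fun _ _ hx => hx⟩
  tfae_finish
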